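/- Let $p$ be a prime, $n\ge 1$, $q=p^n$, and let $R$ be a commutative $\mathbb F_p$-algebra. For a commutative $\mathbb F_p$-algebra $K$ and $\lambda\in K$ let $A_K^{(\lambda)}=K[T]/(T^{q})$ with comultiplication $T\mapsto T\otimes 1+1\otimes T+\lambda\,T\otimes T$, and let $$S_K^{(\lambda)}=K\big[X_1,X_T,\dots,X_{T^{q-1}},\tfrac1{\Delta_{(\lambda)}}\big],\qquad \Delta_{(\lambda)}=\prod_{r=0}^{q-1}\sum_{k=0}^{r}\binom rk\lambda^kX_{T^k}\quad(X_{T^0}=X_1),$$ with comultiplication $X_{T^s}\mapsto\sum_{l=0}^{s}\binom sl\Big(\sum_{k=0}^{l}\binom lk\lambda^kX_{T^{k+s-l}}\Big)\otimes X_{T^l}$. Let $\rho:S_K^{(\lambda)}\to S_K^{(\lambda)}\otimes_K A_K^{(\lambda)}$ be the coaction obtained by composing this comultiplication with $\mathrm{id}\otimes j^{\#}$, where $j^{\#}(X_{T^s})=T^s$; let $C_K^{(\lambda)}=\{b\in S_K^{(\lambda)}:\rho(b)=b\otimes1\}$ be the algebra of coinvariants; and let $\Psi_K^{(\lambda)}:C_K^{(\lambda)}\otimes_K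 A_K^{(\lambda)}\to S_K^{(\lambda)}$ be the $K$-linear map $b\otimes T^k\mapsto bX_{T^k}$ $(0\le k\le q-1)$. Let $\Lambda$ be an indeterminate. In $S_{R[\Lambda,1/\Lambda]}^{(\Lambda)}$ define recursively, for $2\le s\le q-1$, $$P_{(\Lambda)}(X_T^s)=\frac1{\Lambda^s}\Big\{\frac{(X_1+\Lambda X_T)^sX_1}{\sum_{k=0}^s\binom sk\Lambda^kX_{T^k}}-X_1^s-\sum_{k=2}^{s-1}\binom sk\Lambda^kX_1^{s-k}P_{(\Lambda)}(X_T^k)\Big\}.$$ The canonical map $S_{R[\Lambda]}^{(\Lambda)}\to S_{R[\Lambda,1/\Lambda]}^{(\Lambda)}$ is injective; regard it as an inclusion. Then for all $2\le s\le q-1$: 1. $P_{(\Lambda)}(X_T^s)\in S_{R[\Lambda]}^{(\Lambda)}=R[\Lambda][X_1,X_T,\dots,X_{T^{q-1}},1/\Delta_{(\Lambda)}]$, and $P_{(\Lambda)}(X_T^s)$ is a coinvariant there. 2. For every $\lambda\in R$, the image $P_{(\lambda)}(X_T^s)\in S_R^{(\lambda)}$ of $P_{(\Lambda)}(X_T^s)$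 under the substitution $\Lambda\mapsto\lambda$ is a coinvariant. 3. There are $a_0,\dots,a_{q-1}\in R[\Lambda][X_1^{\pm1},P_{(\Lambda)}(X_T^2),\dots,P_{(\Lambda)}(X_T^{q-1})]$, all coinvariants, such that $\sum_{k=0}^{q-1}a_k\otimes T^k$ is the unique preimage of $X_T^s$ under $\Psi_{R[\Lambda]}^{(\Lambda)}$, and also under $\Psi_{R[\Lambda,1/\Lambda]}^{(\Lambda)}$. For every $\lambda\in R$, their images under $\Lambda\mapsto\lambda$ are coinvariants in $R[X_1^{\pm1},P_{(\lambda)}(X_T^2),\dots,P_{(\lambda)}(X_T^{q-1})]$, and $\sum_k a_k|_{\Lambda=\lambda}\otimes T^k$ is the unique preimage of $X_T^s$ under $\Psi_R^{(\lambda)}$. -/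

import Mathlib

open scoped TensorProduct Polynomial LaurentPolynomial

namespace GrothendieckResolution

noncomputable section

/-! ### The Hopf algebra `A_K^{(λ)} = K[T]/(T^{p^n})` -/

/-- The algebra `K[T]/(T^q)`. -/
abbrev A (K : Type*) [CommRing K] (q : ℕ) : Type _ :=
  AdjoinRoot (Polynomial.X ^ q : K[X])

/-- The class of `T` in `K[T]/(T^q)`. -/
abbrev tA (K : Type*) [CommRing K] (q : ℕ) : A K q :=
  AdjoinRoot.root (Polynomial.X ^ q : K[X])

lemma tA_pow (K : Type*) [CommRing K] (q : ℕ) : tA K q ^ q = 0 := by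
  have h := AdjoinRoot.eval₂_root (Polynomial.X ^ q : K[X])
  simpa [Polynomial.eval₂_pow] using h

lemma add_pow_prime_pow {K B : Type*} (p n : ℕ) [Fact p.Prime] [CommRing K] [Algebra (ZMod p) K]
    [CommRing B] [Algebra K B] (x y : B) : (x + y) ^ p ^ n = x ^ p ^ n + y ^ p ^ n := by
  rcases subsingleton_or_nontrivial B with h | h
  · exact Subsingleton.elim _ _
  · let f : ZMod p →+* B := (algebraMap K B).comp (algebraMap (ZMod p) K)
    have : CharP B p := charP_of_injective_ringHom f.injective p
    exact add_pow_char_pow x y p n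

/-- The element `T ⊗ 1 + 1 ⊗ T + λ T ⊗ T`. -/
def comulT {K : Type*} [CommRing K] (q : ℕ) (lam : K) : A K q ⊗[K] A K q :=
  tA K q ⊗ₜ 1 + 1 ⊗ₜ tA K q + lam • (tA K q ⊗ₜ tA K q)

lemma comulT_pow {K : Type*} (p n : ℕ) [Fact p.Prime] [CommRing K] [Algebra (ZMod p) K]
    (lam : K) : comulT (p ^ n) lam ^ p ^ n = 0 := by
  have hq : p ^ n ≠ 0 := pow_ne_zero _ (Fact.out : p.Prime).ne_zero
  rw [comulT, add_pow_prime_pow (K := K), add_pow_prime_pow (K := K), smul_pow]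
  simp [Algebra.TensorProduct.tmul_pow, tA_pow]

/-- The comultiplication of `A_K^{(λ)}`: `T ↦ T ⊗ 1 + 1 ⊗ T + λ T ⊗ T`. -/
def comulA {K : Type*} (p n : ℕ) [Fact p.Prime] [CommRing K] [Algebra (ZMod p) K] (lam : K) :
    A K (p ^ n) →ₐ[K] A K (p ^ n) ⊗[K] A K (p ^ n) :=
  AdjoinRoot.liftAlgHom (Polynomial.X ^ p ^ n : K[X]) (Algebra.ofId K _) (comulT (p ^ n) lam)
    (by simp [Polynomial.eval₂_pow, comulT_pow])

/-! ### The coordinate ring `S(A_K^{(λ)})_Θ = K[X_1, X_T, …, X_{T^{q-1}}, 1/Δ]` -/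

/-- The variable `X_{T^k}` for `k < q` (and `0` for `k ≥ q`, where `T^k = 0`). -/
def xPoly (K : Type*) [CommRing K] (q k : ℕ) : MvPolynomial (Fin q) K :=
  if h : k < q then MvPolynomial.X ⟨k, h⟩ else 0

/-- The linear form `∑_{k=0}^r binom(r,k) λ^k X_{T^k}`. -/
def yPoly {K : Type*} [CommRing K] (q : ℕ) (lam : K) (r : ℕ) : MvPolynomial (Fin q) K :=
  ∑ k ∈ Finset.range (r + 1), ((r.choose k : K) * lam ^ k) • xPoly K q k

/-- `Δ = ∏_{r=0}^{q-1} ∑_{k=0}^r binom(r,k) λ^k X_{T^k}`. -/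
def deltaPoly {K : Type*} [CommRing K] (q : ℕ) (lam : K) : MvPolynomial (Fin q) K :=
  ∏ r ∈ Finset.range q, yPoly q lam r

/-- The ring `K[X_1, X_T, …, X_{T^{q-1}}, 1/Δ]`. -/
abbrev S {K : Type*} [CommRing K] (q : ℕ) (lam : K) : Type _ :=
  Localization.Away (deltaPoly q lam)

/-- `X_{T^k}` as an element of `K[X_1, X_T, …, X_{T^{q-1}}, 1/Δ]`. -/
def x {K : Type*} [CommRing K] (q : ℕ) (lam : K) (k : ℕ) : S q lam :=
  algebraMap (MvPolynomial (Fin q) K) (S q lam) (xPoly K q k)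

/-- `∑_{k=0}^r binom(r,k) λ^k X_{T^k}` as an element of `K[X_1, X_T, …, X_{T^{q-1}}, 1/Δ]`. -/
def y {K : Type*} [CommRing K] (q : ℕ) (lam : K) (r : ℕ) : S q lam :=
  ∑ k ∈ Finset.range (r + 1), ((r.choose k : K) * lam ^ k) • x q lam k

/-- The `K`-linear map `A_K^{(λ)} → S(A_K^{(λ)})_Θ` with `T^k ↦ X_{T^k}` for `0 ≤ k ≤ q - 1`. -/
def psi {K : Type*} [CommRing K] (q : ℕ) (lam : K) : A K q →ₗ[K] S q lam :=
  (∑ k ∈ Finset.range q, (Polynomial.lcoeff K k).smulRight (x q lam k)) ∘ₗ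
    AdjoinRoot.modByMonicHom (Polynomial.monic_X_pow q)

lemma psi_pow {K : Type*} [CommRing K] (q : ℕ) (lam : K) (k : ℕ) :
    psi q lam (tA K q ^ k) = x q lam k := by
  by_cases hk : k < q
  · have h : tA K q ^ k = AdjoinRoot.mk (Polynomial.X ^ q : K[X]) (Polynomial.X ^ k) := by simp
    have hm : (Polynomial.X ^ k : K[X]) %ₘ Polynomial.X ^ q = Polynomial.X ^ k := by
      rcases subsingleton_or_nontrivial K with hK | hK
      · exact Subsingleton.elim _ _
      · rw [Polynomial.modByMonic_eq_self_iff (Polynomial.monic_X_pow q),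
          Polynomial.degree_X_pow, Polynomial.degree_X_pow]
        exact_mod_cast hk
    rw [psi, h, LinearMap.comp_apply, AdjoinRoot.modByMonicHom_mk, hm]
    simp only [LinearMap.coe_sum, Finset.sum_apply, LinearMap.smulRight_apply,
      Polynomial.lcoeff_apply, Polynomial.coeff_X_pow, ite_smul, one_smul, zero_smul]
    simp [hk]
  · have h : tA K q ^ k = 0 := pow_eq_zero_of_le (not_lt.mp hk) (tA_pow K q)
    simp [h, x, xPoly, hk]

lemma psi_add_pow {K : Type*} [CommRing K] (q : ℕ) (lam : K) (r : ℕ) :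
    psi q lam ((1 + lam • tA K q) ^ r) = y q lam r := by
  rw [add_comm, add_pow, map_sum, y]
  refine Finset.sum_congr rfl fun k _ => ?_
  rw [← psi_pow, ← map_smul]
  congr 1
  rw [smul_pow, one_pow, mul_one, mul_smul, Nat.cast_smul_eq_nsmul, nsmul_eq_mul, mul_comm]

lemma algebraMap_yPoly {K : Type*} [CommRing K] (q : ℕ) (lam : K) (r : ℕ) :
    algebraMap (MvPolynomial (Fin q) K) (S q lam) (yPoly q lam r) = y q lam r := by
  simp only [yPoly, y, map_sum, x, Algebra.smul_def, map_mul]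
  simp only [← IsScalarTower.algebraMap_apply]

lemma isUnit_y {K : Type*} [CommRing K] (q : ℕ) (lam : K) {r : ℕ} (hr : r < q) :
    IsUnit (y q lam r) := by
  have h : IsUnit (algebraMap (MvPolynomial (Fin q) K) (S q lam)
      (∏ r ∈ Finset.range q, yPoly q lam r)) :=
    IsLocalization.Away.algebraMap_isUnit (deltaPoly q lam)
  rw [map_prod] at h
  have h' := isUnit_of_dvd_unit (Finset.dvd_prod_of_mem _ (Finset.mem_range.mpr hr)) h
  rwa [algebraMap_yPoly] at h'

/-! ### The right `A_K^{(λ)}`-comodule algebra structure of `S(A_K^{(λ)})_Θ` -/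

/-- To define a `K`-algebra map out of `K[X_1, …, X_{T^{q-1}}, 1/Δ]`, prescribe the images of the
variables such that the images of the factors of `Δ` are units. -/
def liftS {K B : Type*} [CommRing K] [CommRing B] [Algebra K B] (q : ℕ) (lam : K) (g : Fin q → B)
    (hg : ∀ r < q, IsUnit (MvPolynomial.aeval g (yPoly q lam r))) : S q lam →ₐ[K] B :=
  IsLocalization.liftAlgHom (M := Submonoid.powers (deltaPoly q lam))
    (f := (MvPolynomial.aeval g : MvPolynomial (Fin q) K →ₐ[K] B)) (by
      rintro ⟨_, m, rfl⟩
      have h : IsUnit (MvPolynomial.aeval g (deltaPoly q lam)) := by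
        rw [deltaPoly, map_prod]
        exact IsUnit.prod_iff.mpr fun r hr => hg r (Finset.mem_range.mp hr)
      simpa using h.pow m)

lemma aeval_xPoly {K B : Type*} [CommRing K] [CommRing B] [Algebra K B] (q : ℕ)
    (L : A K q →ₗ[K] B) (k : ℕ) :
    MvPolynomial.aeval (fun i : Fin q => L (tA K q ^ (i : ℕ))) (xPoly K q k) =
      L (tA K q ^ k) := by
  by_cases hk : k < q
  · simp [xPoly, hk]
  · have h : tA K q ^ k = 0 := pow_eq_zero_of_le (not_lt.mp hk) (tA_pow K q)
    simp [xPoly, hk, h]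

lemma aeval_yPoly {K B : Type*} [CommRing K] [CommRing B] [Algebra K B] (q : ℕ) (lam : K)
    (L : A K q →ₗ[K] B) (r : ℕ) :
    MvPolynomial.aeval (fun i : Fin q => L (tA K q ^ (i : ℕ))) (yPoly q lam r) =
      L ((1 + lam • tA K q) ^ r) := by
  rw [yPoly, map_sum, add_comm (1 : A K q), add_pow, map_sum]
  refine Finset.sum_congr rfl fun k _ => ?_
  rw [map_smul, aeval_xPoly, ← map_smul]
  congr 1
  rw [smul_pow, one_pow, mul_one, mul_smul, Nat.cast_smul_eq_nsmul, nsmul_eq_mul, mul_comm]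

lemma comulA_add_pow {K : Type*} (p n : ℕ) [Fact p.Prime] [CommRing K] [Algebra (ZMod p) K]
    (lam : K) (r : ℕ) :
    comulA p n lam ((1 + lam • tA K (p ^ n)) ^ r) =
      ((1 + lam • tA K (p ^ n)) ^ r) ⊗ₜ ((1 + lam • tA K (p ^ n)) ^ r) := by
  have h : comulA p n lam (tA K (p ^ n)) = comulT (p ^ n) lam := by
    simp [comulA]
  rw [map_pow, ← Algebra.TensorProduct.tmul_pow]
  congr 1
  rw [map_add, map_one, map_smul, h, comulT]
  simp only [TensorProduct.add_tmul, TensorProduct.tmul_add, TensorProduct.smul_tmul',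
    TensorProduct.tmul_smul, smul_add, Algebra.TensorProduct.one_def]
  abel

/-- The comultiplication of `S(A_K^{(λ)})_Θ`. It is the algebra map with
`X_a ↦ ∑ X_{a_(1)} ⊗ X_{a_(2)}` where `Δ(a) = ∑ a_(1) ⊗ a_(2)` in `A_K^{(λ)}`, for `a = T^s`. -/
def comulS {K : Type*} (p n : ℕ) [Fact p.Prime] [CommRing K] [Algebra (ZMod p) K] (lam : K) :
    S (p ^ n) lam →ₐ[K] S (p ^ n) lam ⊗[K] S (p ^ n) lam :=
  liftS (p ^ n) lam
    (fun i => (TensorProduct.map (psi (p ^ n) lam) (psi (p ^ n) lam) ∘ₗ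
      (comulA p n lam).toLinearMap) (tA K (p ^ n) ^ (i : ℕ)))
    (fun r hr => by
      rw [aeval_yPoly, LinearMap.comp_apply, AlgHom.toLinearMap_apply, comulA_add_pow,
        TensorProduct.map_tmul, psi_add_pow]
      have hu := isUnit_y (p ^ n) lam hr
      have h := (hu.map (Algebra.TensorProduct.includeLeft :
          S (p ^ n) lam →ₐ[K] S (p ^ n) lam ⊗[K] S (p ^ n) lam)).mul
        (hu.map (Algebra.TensorProduct.includeRight :
          S (p ^ n) lam →ₐ[K] S (p ^ n) lam ⊗[K] S (p ^ n) lam))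
      simpa using h)

/-- The algebra map `S(A_K^{(λ)})_Θ → A_K^{(λ)}`, `X_{T^s} ↦ T^s`, of the closed immersion of the
group scheme `Spec A_K^{(λ)}` into the unit group scheme of its group algebra. -/
def jSharp {K : Type*} [CommRing K] (q : ℕ) (lam : K) : S q lam →ₐ[K] A K q :=
  liftS q lam (fun i => (LinearMap.id : A K q →ₗ[K] A K q) (tA K q ^ (i : ℕ)))
    (fun r _ => by
      rw [aeval_yPoly, LinearMap.id_apply]
      refine IsUnit.pow r (IsNilpotent.isUnit_one_add ⟨q, ?_⟩)
      rw [smul_pow, tA_pow, smul_zero])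

/-- The right coaction `ρ = (id ⊗ j^#) ∘ Δ : S(A_K^{(λ)})_Θ → S(A_K^{(λ)})_Θ ⊗ A_K^{(λ)}`. -/
def rho {K : Type*} (p n : ℕ) [Fact p.Prime] [CommRing K] [Algebra (ZMod p) K] (lam : K) :
    S (p ^ n) lam →ₐ[K] S (p ^ n) lam ⊗[K] A K (p ^ n) :=
  (Algebra.TensorProduct.map (AlgHom.id K (S (p ^ n) lam)) (jSharp (p ^ n) lam)).comp
    (comulS p n lam)

/-- The subalgebra of coinvariants `{b | ρ(b) = b ⊗ 1}`. -/
def coinv {K : Type*} (p n : ℕ) [Fact p.Prime] [CommRing K] [Algebra (ZMod p) K] (lam : K) :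
    Subalgebra K (S (p ^ n) lam) :=
  AlgHom.equalizer (rho p n lam) Algebra.TensorProduct.includeLeft

/-- The map `Ψ : S^{co A} ⊗ A → S`, `b ⊗ a ↦ b ψ(a)`. -/
def Psi {K : Type*} (p n : ℕ) [Fact p.Prime] [CommRing K] [Algebra (ZMod p) K] (lam : K) :
    coinv p n lam ⊗[K] A K (p ^ n) →ₗ[K] S (p ^ n) lam :=
  LinearMap.mul' K (S (p ^ n) lam) ∘ₗ
    TensorProduct.map (coinv p n lam).val.toLinearMap (psi (p ^ n) lam)

/-- `Ψ⁻¹(z) = ∑_k a_k ⊗ T^k` with coinvariants `a_k`: the right-hand side is the one and only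
preimage of `z` under `Ψ`. -/
def PsiInvEq {K : Type*} (p n : ℕ) [Fact p.Prime] [CommRing K] [Algebra (ZMod p) K] (lam : K)
    (z : S (p ^ n) lam) (a : Fin (p ^ n) → S (p ^ n) lam) : Prop :=
  ∃ h : ∀ k, a k ∈ coinv p n lam,
    Psi p n lam ⁻¹' {z} =
      {∑ k, (⟨a k, h k⟩ : coinv p n lam) ⊗ₜ[K] (tA K (p ^ n) ^ (k : ℕ))}

/-! ### Change of the base ring -/

lemma map_yPoly {K L : Type*} [CommRing K] [CommRing L] (f : K →+* L) (q : ℕ) {lam : K} {mu : L}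
    (h : f lam = mu) (r : ℕ) : MvPolynomial.map f (yPoly q lam r) = yPoly q mu r := by
  subst h
  simp only [yPoly, map_sum, MvPolynomial.smul_eq_C_mul, map_mul, MvPolynomial.map_C, map_pow,
    map_natCast]
  refine Finset.sum_congr rfl fun k _ => ?_
  congr 1
  unfold xPoly
  split <;> simp

lemma map_deltaPoly {K L : Type*} [CommRing K] [CommRing L] (f : K →+* L) (q : ℕ) {lam : K}
    {mu : L} (h : f lam = mu) : MvPolynomial.map f (deltaPoly q lam) = deltaPoly q mu := by
  simp only [deltaPoly, map_prod, map_yPoly f q h]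

/-- For a ring map `f : K → L` with `f(λ) = μ`, the ring map
`K[X_1, …, X_{T^{q-1}}, 1/Δ_(λ)] → L[X_1, …, X_{T^{q-1}}, 1/Δ_(μ)]` that is `f` on coefficients
and sends `X_{T^k}` to `X_{T^k}`. -/
def baseChange {K L : Type*} [CommRing K] [CommRing L] (f : K →+* L) (q : ℕ) {lam : K} {mu : L}
    (h : f lam = mu) : S q lam →+* S q mu :=
  IsLocalization.Away.lift (deltaPoly q lam)
    (g := (algebraMap (MvPolynomial (Fin q) L) (S q mu)).comp (MvPolynomial.map f)) (by
      rw [RingHom.comp_apply, map_deltaPoly f q h]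
      exact IsLocalization.Away.algebraMap_isUnit _)

/-- The canonical map from `R[Λ][X_1, …, X_{T^{q-1}}, 1/Δ_(Λ)]` to
`R[Λ, 1/Λ][X_1, …, X_{T^{q-1}}, 1/Δ_(Λ)]`. -/
def toLaurentS (R : Type*) [CommRing R] (q : ℕ) :
    S q (Polynomial.X : R[X]) →+* S q (LaurentPolynomial.T 1 : R[T;T⁻¹]) :=
  baseChange Polynomial.toLaurent q Polynomial.toLaurent_X

/-- The substitution `Λ ↦ λ`, from `R[Λ][X_1, …, X_{T^{q-1}}, 1/Δ_(Λ)]` to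
`R[X_1, …, X_{T^{q-1}}, 1/Δ_(λ)]`. -/
def specialize {R : Type*} [CommRing R] (q : ℕ) (lam : R) :
    S q (Polynomial.X : R[X]) →+* S q lam :=
  baseChange (Polynomial.evalRingHom lam) q (by simp)

/-! ### The elements `P_(Λ)(X_T^s)` -/

/-- The element `P_(Λ)(X_T^s)` of `R[Λ, 1/Λ][X_1, …, X_{T^{q-1}}, 1/Δ_(Λ)]`, given by
`Λ^{-s} { (X_1 + Λ X_T)^s X_1 / (∑_{k=0}^s binom(s,k) Λ^k X_{T^k}) - X_1^s
  - ∑_{k=2}^{s-1} binom(s,k) Λ^k X_1^{s-k} P_(Λ)(X_T^k) }`.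
Only `2 ≤ s ≤ q - 1` is meaningful; there the denominator is a unit. -/
def P (R : Type*) [CommRing R] (q : ℕ) (s : ℕ) : S q (LaurentPolynomial.T 1 : R[T;T⁻¹]) :=
  let Lam : R[T;T⁻¹] := LaurentPolynomial.T 1
  (LaurentPolynomial.T (-(s : ℤ)) : R[T;T⁻¹]) •
    ((x q Lam 0 + Lam • x q Lam 1) ^ s * x q Lam 0 * Ring.inverse (y q Lam s)
      - x q Lam 0 ^ s
      - ∑ k : Fin s, if 2 ≤ (k : ℕ) then
          ((s.choose k : R[T;T⁻¹]) * Lam ^ (k : ℕ)) • (x q Lam 0 ^ (s - k) * P R q k) else 0)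
termination_by s
decreasing_by exact k.2

/-- The generators `X_1^{±1}, Q_2, …, Q_{q-1}` for a family `Q` of elements. -/
def gens {K : Type*} [CommRing K] (q : ℕ) (lam : K) (Q : ℕ → S q lam) : Set (S q lam) :=
  {x q lam 0, Ring.inverse (x q lam 0)} ∪ Q '' Set.Icc 2 (q - 1)

end

end GrothendieckResolution

namespace GrothendieckResolution
open Finset

/-! ### Forward differences divisible by powers of a fixed element -/

/-! Since `1 + λT` is group-like in `A`, the elements `y r = psi ((1 + λT) ^ r)` satisfy `ρ(y r) = y
r ⊗ (1 + λT) ^ r`. Hence `ratio k = (y 1 / x 0) ^ k * x 0 / y k` is coinvariant. The recursion for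
`P` is the Newton expansion of `k ↦ ratio k`: it says that `Λ ^ s P_s` is `x 0 ^ s` times the `s`-th
forward difference of `ratio` at `0`, with `P_0 = 1` and `P_1 = 0`.

Integrality thus means that the `s`-th differences of `ratio` are divisible by `Λ ^ s`. This
property is stable under products and inverses by the Leibniz rule. It holds for `y`, the image of a
geometric sequence under an additive map, and for `ratio * y`, which is `x 0` times a geometric
sequence (`diffDvd_ratio`). Coinvariance of the quotients follows because `Λ` is regular on flat
modules.

The Leibniz rule for the `s`-th difference of `ratio * y` at `0`, divided by `Λ ^ s`, expresses `x 1
^ s` through coinvariants and the `x k` (`x_one_pow_eq_sum`); this is the preimage under `Ψ`. It is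
unique because `ρ(x k)` is triangular in the powers of `T` with unit leading coefficients `y k`
(`eq_zero_of_sum_mul_x_eq_zero`). The coaction commutes with base change (`baseChange_mem_coinv`),
so everything proved over `R[Λ]` passes to `R[Λ, 1/Λ]` and to each `λ`. -/

lemma fwdDiff_iter_mul {B : Type*} [CommRing B] (f h : ℕ → B) (s m : ℕ) :
    (fwdDiff 1)^[s] (f * h) m = ∑ ij ∈ antidiagonal s,
      (s.choose ij.1 : B) * ((fwdDiff 1)^[ij.1] f m * (fwdDiff 1)^[ij.2] h (m + ij.1)) := by
  induction s generalizing f h with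
  | zero => simp
  | succ s ih =>
    have h1 : fwdDiff 1 (f * h) = f * fwdDiff 1 h + fwdDiff 1 f * fun k => h (k + 1) := by
      funext k
      simp only [fwdDiff, Pi.mul_apply, Pi.add_apply]
      ring
    rw [Function.iterate_succ_apply, h1, fwdDiff_iter_add, Pi.add_apply, ih, ih,
      sum_antidiagonal_choose_succ_mul
        (fun i j => (fwdDiff 1)^[i] f m * (fwdDiff 1)^[j] h (m + i))]
    refine congrArg₂ _ rfl (sum_congr rfl fun ij hij => ?_)
    rw [HasAntidiagonal.mem_antidiagonal] at hij
    rw [Nat.choose_symm_of_eq_add hij.symm, fwdDiff_iter_comp_add, Function.iterate_succ_apply,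
      add_assoc, add_comm ij.1]

/-- The `s`-th forward differences of `f` are divisible by `c ^ s`, for all `s`. -/
def DiffDvd {B : Type*} [CommRing B] (c : B) (f : ℕ → B) : Prop :=
  ∀ s m, c ^ s ∣ (fwdDiff 1)^[s] f m

lemma DiffDvd.mul {B : Type*} [CommRing B] {c : B} {f h : ℕ → B} (hf : DiffDvd c f)
    (hh : DiffDvd c h) : DiffDvd c (f * h) := by
  intro s m
  rw [fwdDiff_iter_mul]
  refine dvd_sum fun ij hij => Dvd.dvd.mul_left ?_ _
  rw [← HasAntidiagonal.mem_antidiagonal.mp hij, pow_add]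
  exact mul_dvd_mul (hf _ _) (hh _ _)

/-- In the Leibniz expansion of the vanishing `s`-th difference of `f * h`, the term `f m * Δ^s h m`
has a unit factor, and every other term involves only lower differences of `h`. -/
lemma DiffDvd.of_mul_eq_one {B : Type*} [CommRing B] {c : B} {f h : ℕ → B} (hf : DiffDvd c f)
    (hfh : f * h = 1) : DiffDvd c h := by
  intro s
  induction s using Nat.strong_induction_on with
  | _ s ih =>
    intro m
    rcases Nat.eq_zero_or_pos s with rfl | hs
    · simp
    have h0 : (fwdDiff 1)^[s] (f * h) m = 0 := by
      rw [hfh]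
      obtain ⟨t, rfl⟩ := Nat.exists_eq_succ_of_ne_zero hs.ne'
      rw [Function.iterate_succ_apply]
      -- Written as a zero multiple, the difference is killed under all further iterates by
      -- linearity.
      have h1 : fwdDiff 1 (1 : ℕ → B) = (0 : ℤ) • 1 := by
        funext k
        simp [fwdDiff]
      rw [h1, fwdDiff_iter_const_smul, zero_smul, Pi.zero_apply]
    have hu : IsUnit (f m) := .of_mul_eq_one (h m) (congrFun hfh m)
    rw [fwdDiff_iter_mul, ← add_sum_erase _ _ (show (0, s) ∈ antidiagonal s by simp)] at h0
    rw [← hu.dvd_mul_left]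
    have h2 := eq_neg_of_add_eq_zero_left h0
    simp only [Nat.choose_zero_right, Nat.cast_one, one_mul, Function.iterate_zero, id_eq,
      add_zero] at h2
    rw [h2, dvd_neg]
    refine dvd_sum fun ij hij => Dvd.dvd.mul_left ?_ _
    rw [mem_erase, HasAntidiagonal.mem_antidiagonal] at hij
    have h3 : ij.2 < s := by
      by_contra h4
      exact hij.1 (Prod.ext (by omega) (by omega))
    rw [← hij.2, pow_add]
    exact mul_dvd_mul (hf _ _) (ih _ h3 _)

lemma fwdDiff_iter_one_add_pow {B : Type*} [CommRing B] (v : B) (s m : ℕ) :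
    (fwdDiff 1)^[s] (fun k => (1 + v) ^ k) m = v ^ s * (1 + v) ^ m := by
  induction s generalizing m with
  | zero => simp
  | succ s ih =>
    rw [Function.iterate_succ_apply', fwdDiff, ih, ih]
    ring

lemma fwdDiff_iter_map {G H : Type*} [AddCommGroup G] [AddCommGroup H] (φ : G →+ H) (f : ℕ → G)
    (s m : ℕ) : (fwdDiff 1)^[s] (fun k => φ (f k)) m = φ ((fwdDiff 1)^[s] f m) := by
  induction s generalizing m with
  | zero => simp
  | succ s ih => rw [Function.iterate_succ_apply', Function.iterate_succ_apply', fwdDiff, fwdDiff,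
      ih, ih, map_sub]

/-! ### The basis of powers of `T` -/

section Basis

variable {K : Type*} [CommRing K] (q : ℕ)

lemma A_linearMap_ext {M : Type*} [AddCommMonoid M] [Module K M] {f g : A K q →ₗ[K] M}
    (h : ∀ k, f (tA K q ^ k) = g (tA K q ^ k)) : f = g := by
  refine LinearMap.ext fun a => ?_
  obtain ⟨c, rfl⟩ := AdjoinRoot.mk_surjective a
  induction c using Polynomial.induction_on' with
  | add c d hc hd => rw [map_add, map_add, map_add, hc, hd]
  | monomial k r =>
    have h1 : AdjoinRoot.mk (Polynomial.X ^ q : K[X]) (Polynomial.monomial k r) =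
        r • tA K q ^ k := by
      rw [← Polynomial.C_mul_X_pow_eq_monomial, map_mul, map_pow, AdjoinRoot.mk_X,
        AdjoinRoot.mk_C, Algebra.smul_def, AdjoinRoot.algebraMap_eq]
    rw [h1, map_smul, map_smul, h]

/-- The linear form on `K[T]/(T^q)` that gives the coefficient of `T^k`. -/
noncomputable def coeffA (K : Type*) [CommRing K] (q k : ℕ) : A K q →ₗ[K] K :=
  Polynomial.lcoeff K k ∘ₗ AdjoinRoot.modByMonicHom (Polynomial.monic_X_pow q)

lemma coeffA_pow (k : ℕ) {l : ℕ} (hl : l < q) :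
    coeffA K q k (tA K q ^ l) = if l = k then 1 else 0 := by
  have h : tA K q ^ l = AdjoinRoot.mk (Polynomial.X ^ q : K[X]) (Polynomial.X ^ l) := by simp
  have hm : (Polynomial.X ^ l : K[X]) %ₘ Polynomial.X ^ q = Polynomial.X ^ l := by
    rcases subsingleton_or_nontrivial K with hK | hK
    · exact Subsingleton.elim _ _
    · rw [Polynomial.modByMonic_eq_self_iff (Polynomial.monic_X_pow q),
        Polynomial.degree_X_pow, Polynomial.degree_X_pow]
      exact_mod_cast hl
  rw [coeffA, h, LinearMap.comp_apply, AdjoinRoot.modByMonicHom_mk, hm, Polynomial.lcoeff_apply,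
    Polynomial.coeff_X_pow]
  simp only [eq_comm]

lemma sum_coeffA_smul (a : A K q) : ∑ k : Fin q, coeffA K q k a • tA K q ^ (k : ℕ) = a := by
  have h : ∑ k : Fin q, (coeffA K q k).smulRight (tA K q ^ (k : ℕ)) = LinearMap.id := by
    refine A_linearMap_ext q fun l => ?_
    by_cases hl : l < q
    · rw [LinearMap.sum_apply, sum_eq_single (⟨l, hl⟩ : Fin q)]
      · simp [coeffA_pow q _ hl]
      · intro k _ hk
        have : l ≠ k := fun h => hk (Fin.ext h.symm)
        simp [coeffA_pow q _ hl, this]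
      · simp
    · rw [pow_eq_zero_of_le (not_lt.mp hl) (tA_pow K q), map_zero, map_zero]
  simpa using LinearMap.congr_fun h a

lemma exists_sum_tmul_pow {M : Type*} [AddCommGroup M] [Module K M] (w : M ⊗[K] A K q) :
    ∃ b : Fin q → M, w = ∑ k, b k ⊗ₜ[K] (tA K q ^ (k : ℕ)) := by
  induction w with
  | zero => exact ⟨0, by simp⟩
  | add v w hv hw =>
    obtain ⟨b, rfl⟩ := hv
    obtain ⟨c, rfl⟩ := hw
    exact ⟨b + c, by simp [TensorProduct.add_tmul, sum_add_distrib]⟩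
  | tmul m a =>
    refine ⟨fun k => coeffA K q k a • m, ?_⟩
    conv_lhs => rw [← sum_coeffA_smul q a]
    simp only [TensorProduct.tmul_sum, TensorProduct.tmul_smul, TensorProduct.smul_tmul']

/-- The coefficient of `T^k`, from `M ⊗ K[T]/(T^q)` to `M`. -/
noncomputable def coeffTensor {K : Type*} [CommRing K] (M : Type*) [AddCommGroup M] [Module K M]
    (q k : ℕ) : M ⊗[K] A K q →ₗ[K] M :=
  (TensorProduct.rid K M).toLinearMap ∘ₗ (coeffA K q k).lTensor M

lemma coeffTensor_tmul_pow {M : Type*} [AddCommGroup M] [Module K M] (k : ℕ) {l : ℕ} (hl : l < q)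
    (m : M) : coeffTensor M q k (m ⊗ₜ[K] (tA K q ^ l)) = if l = k then m else 0 := by
  rw [coeffTensor, LinearMap.comp_apply, LinearMap.lTensor_tmul, coeffA_pow q k hl]
  split <;> simp

end Basis

/-! ### The coaction on the generators -/

section Coaction

variable {K : Type*} [CommRing K]

lemma liftS_algebraMap {B : Type*} [CommRing B] [Algebra K B] (q : ℕ) (lam : K) (g : Fin q → B)
    (hg : ∀ r < q, IsUnit (MvPolynomial.aeval g (yPoly q lam r))) (f : MvPolynomial (Fin q) K) :
    liftS q lam g hg (algebraMap _ _ f) = MvPolynomial.aeval g f := by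
  simp [liftS]

lemma jSharp_psi (q : ℕ) (lam : K) (a : A K q) : jSharp q lam (psi q lam a) = a := by
  have h : (jSharp q lam).toLinearMap ∘ₗ psi q lam = LinearMap.id := by
    refine A_linearMap_ext q fun k => ?_
    rw [LinearMap.comp_apply, psi_pow, x, AlgHom.toLinearMap_apply, jSharp, liftS_algebraMap,
      aeval_xPoly]
  exact LinearMap.congr_fun h a

variable (p n : ℕ) [Fact p.Prime] [Algebra (ZMod p) K] (lam : K)

lemma comulS_psi (a : A K (p ^ n)) : comulS p n lam (psi (p ^ n) lam a) =
    TensorProduct.map (psi (p ^ n) lam) (psi (p ^ n) lam) (comulA p n lam a) := by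
  have h : (comulS p n lam).toLinearMap ∘ₗ psi (p ^ n) lam =
      TensorProduct.map (psi (p ^ n) lam) (psi (p ^ n) lam) ∘ₗ (comulA p n lam).toLinearMap := by
    refine A_linearMap_ext _ fun k => ?_
    rw [LinearMap.comp_apply, psi_pow, x, AlgHom.toLinearMap_apply, comulS, liftS_algebraMap,
      aeval_xPoly]
  exact LinearMap.congr_fun h a

lemma rho_psi (a : A K (p ^ n)) : rho p n lam (psi (p ^ n) lam a) =
    (psi (p ^ n) lam).rTensor (A K (p ^ n)) (comulA p n lam a) := by
  rw [rho, AlgHom.comp_apply, comulS_psi]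
  induction comulA p n lam a with
  | zero => simp
  | add v w hv hw => simp only [map_add, hv, hw]
  | tmul a b => simp [jSharp_psi]

lemma comulA_pow (s : ℕ) : comulA p n lam (tA K (p ^ n) ^ s) =
    ∑ l ∈ range (s + 1), (s.choose l : K) •
      (((1 + lam • tA K (p ^ n)) ^ l * tA K (p ^ n) ^ (s - l)) ⊗ₜ[K] (tA K (p ^ n) ^ l)) := by
  have h : comulA p n lam (tA K (p ^ n)) =
      (1 + lam • tA K (p ^ n)) ⊗ₜ tA K (p ^ n) + tA K (p ^ n) ⊗ₜ 1 := by
    rw [comulA, AdjoinRoot.liftAlgHom_root, comulT, TensorProduct.add_tmul,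
      TensorProduct.smul_tmul']
    abel
  rw [map_pow, h, add_pow]
  refine sum_congr rfl fun l _ => ?_
  rw [Algebra.TensorProduct.tmul_pow, Algebra.TensorProduct.tmul_pow,
    Algebra.TensorProduct.tmul_mul_tmul, one_pow, mul_one, Nat.cast_smul_eq_nsmul, nsmul_eq_mul,
    mul_comm]

lemma rho_x (s : ℕ) : rho p n lam (x (p ^ n) lam s) = ∑ l ∈ range (s + 1), (s.choose l : K) •
    (psi (p ^ n) lam ((1 + lam • tA K (p ^ n)) ^ l * tA K (p ^ n) ^ (s - l)) ⊗ₜ[K]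
      (tA K (p ^ n) ^ l)) := by
  rw [← psi_pow, rho_psi, comulA_pow, map_sum]
  simp

lemma rho_y (r : ℕ) : rho p n lam (y (p ^ n) lam r) =
    y (p ^ n) lam r ⊗ₜ ((1 + lam • tA K (p ^ n)) ^ r) := by
  rw [← psi_add_pow, rho_psi, comulA_add_pow, LinearMap.rTensor_tmul]

/-- In characteristic `p`, `(1 + λT) ^ q = 1`, so `y` is periodic with period `q`. Thus `y` is
invertible as a sequence on all of `ℕ`, as the difference calculus requires. -/
lemma isUnit_y_of_prime_pow (r : ℕ) : IsUnit (y (p ^ n) lam r) := by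
  have hq : 0 < p ^ n := pow_pos (Fact.out : p.Prime).pos _
  have h : y (p ^ n) lam r = y (p ^ n) lam (r % p ^ n) := by
    rw [← psi_add_pow, ← psi_add_pow]
    congr 1
    conv_lhs => rw [← Nat.mod_add_div r (p ^ n), pow_add, pow_mul, add_pow_prime_pow (K := K),
      smul_pow, tA_pow, one_pow, smul_zero, add_zero, one_pow, mul_one]
  rw [h]
  exact isUnit_y _ _ (Nat.mod_lt _ hq)

lemma y_zero (q : ℕ) (mu : K) : y q mu 0 = x q mu 0 := by simp [y]

lemma y_one (q : ℕ) (mu : K) : y q mu 1 = x q mu 0 + mu • x q mu 1 := by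
  simp [y, sum_range_succ]

lemma mem_coinv {b : S (p ^ n) lam} : b ∈ coinv p n lam ↔ rho p n lam b = b ⊗ₜ 1 := Iff.rfl

/-- The factor `ρ(y r) = y r ⊗ (1 + λT) ^ r` is a unit and can be cancelled. -/
lemma coinv_of_mul_y {b : S (p ^ n) lam} {r : ℕ}
    (h : rho p n lam (b * y (p ^ n) lam r) =
      (b * y (p ^ n) lam r) ⊗ₜ ((1 + lam • tA K (p ^ n)) ^ r)) : b ∈ coinv p n lam := by
  rw [mem_coinv, ← ((isUnit_y_of_prime_pow p n lam r).map (rho p n lam)).mul_left_inj, ← map_mul, h,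
    rho_y, Algebra.TensorProduct.tmul_mul_tmul, one_mul]

lemma x_zero_mem_coinv : x (p ^ n) lam 0 ∈ coinv p n lam := by
  rw [mem_coinv, ← y_zero, rho_y, pow_zero]

lemma isUnit_x_zero : IsUnit (x (p ^ n) lam 0) := by
  rw [← y_zero]
  exact isUnit_y_of_prime_pow p n lam 0

lemma inverse_x_zero_mem_coinv : Ring.inverse (x (p ^ n) lam 0) ∈ coinv p n lam := by
  refine coinv_of_mul_y p n lam (r := 0) ?_
  rw [y_zero, Ring.inverse_mul_cancel _ (isUnit_x_zero p n lam), map_one, pow_zero,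
    Algebra.TensorProduct.one_def]

/-! ### Uniqueness of the preimage under `Ψ` -/

/-- Descending induction on the index: `ρ(x k)` involves only `T ^ m` with `m ≤ k`, and its
coefficient at `T ^ k` is the unit `y k`. Comparing coefficients of `T ^ l` in `ρ` of the relation
therefore isolates `b l * y l`. -/
lemma eq_zero_of_sum_mul_x_eq_zero {b : Fin (p ^ n) → S (p ^ n) lam}
    (hb : ∀ k, b k ∈ coinv p n lam) (h : ∑ k, b k * x (p ^ n) lam k = 0) : b = 0 := by
  have key : ∀ l : Fin (p ^ n), (∀ k, l < k → b k = 0) → b l = 0 := by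
    intro l hl
    have h1 := congrArg (coeffTensor (S (p ^ n) lam) (p ^ n) l ∘ rho p n lam) h
    simp only [Function.comp_apply, map_sum, map_zero, map_mul] at h1
    rw [sum_eq_single l] at h1
    · rw [(mem_coinv p n lam).mp (hb l), rho_x, mul_sum, map_sum,
        sum_eq_single (l : ℕ)] at h1
      · simpa [coeffTensor_tmul_pow _ _ l.2, psi_add_pow,
          (isUnit_y_of_prime_pow p n lam l).mul_left_eq_zero] using h1
      · intro m hm hml
        have hm' : m < p ^ n := (Nat.lt_succ_iff.mp (mem_range.mp hm)).trans_lt l.2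
        rw [mul_smul_comm, Algebra.TensorProduct.tmul_mul_tmul, one_mul, map_smul,
          coeffTensor_tmul_pow _ _ hm', if_neg hml, smul_zero]
      · simp
    · intro k _ hk
      rcases lt_or_gt_of_ne hk with hkl | hkl
      · rw [(mem_coinv p n lam).mp (hb k), rho_x, mul_sum, map_sum]
        refine sum_eq_zero fun m hm => ?_
        have hm' : m < l := (Nat.lt_succ_iff.mp (mem_range.mp hm)).trans_lt hkl
        rw [mul_smul_comm, Algebra.TensorProduct.tmul_mul_tmul, one_mul, map_smul,
          coeffTensor_tmul_pow _ _ (hm'.trans l.2), if_neg hm'.ne, smul_zero]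
      · rw [hl k hkl, map_zero, zero_mul, map_zero]
    · simp
  funext l
  induction l using WellFoundedGT.induction with
  | _ l ih => exact key l ih

lemma Psi_sum (b : Fin (p ^ n) → coinv p n lam) :
    Psi p n lam (∑ k, b k ⊗ₜ[K] (tA K (p ^ n) ^ (k : ℕ))) =
      ∑ k, (b k : S (p ^ n) lam) * x (p ^ n) lam k := by
  simp [Psi, psi_pow]

lemma psiInvEq_of_sum_eq {z : S (p ^ n) lam} {a : Fin (p ^ n) → S (p ^ n) lam}
    (ha : ∀ k, a k ∈ coinv p n lam) (h : ∑ k, a k * x (p ^ n) lam k = z) :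
    PsiInvEq p n lam z a := by
  refine ⟨ha, Set.ext fun w => ?_⟩
  rw [Set.mem_preimage, Set.mem_singleton_iff, Set.mem_singleton_iff]
  obtain ⟨b, rfl⟩ := exists_sum_tmul_pow (p ^ n) w
  constructor
  · intro hw
    rw [Psi_sum] at hw
    have h0 := eq_zero_of_sum_mul_x_eq_zero p n lam (b := fun k => b k - a k)
      (fun k => sub_mem (b k).2 (ha k)) (by simp only [sub_mul, sum_sub_distrib, hw, h, sub_self])
    refine sum_congr rfl fun k _ => ?_
    congr 1
    exact Subtype.ext (sub_eq_zero.mp (congrFun h0 k))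
  · intro hw
    rw [hw, Psi_sum]
    exact h

end Coaction

/-! ### Naturality of the coaction in the base ring -/

/-- Glues maps that are only semilinear over a change of base ring: `B` becomes a `K`-algebra
through `u`. -/
lemma exists_tensorProduct_ringHom {K M N B : Type*} [CommRing K] [CommRing M] [CommRing N]
    [CommRing B] [Algebra K M] [Algebra K N] (u : M →+* B) (v : N →+* B)
    (h : u.comp (algebraMap K M) = v.comp (algebraMap K N)) :
    ∃ Φ : M ⊗[K] N →+* B, ∀ a b, Φ (a ⊗ₜ b) = u a * v b := by
  let _ : Algebra K B := (u.comp (algebraMap K M)).toAlgebra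
  let u' : M →ₐ[K] B := { u with commutes' := fun _ => rfl }
  let v' : N →ₐ[K] B := { v with commutes' := fun c => (RingHom.congr_fun h c).symm }
  exact ⟨(Algebra.TensorProduct.lift u' v' fun _ _ => Commute.all _ _).toRingHom, fun a b =>
    Algebra.TensorProduct.lift_tmul u' v' _ a b⟩

lemma map_ringInverse {B C : Type*} [CommRing B] [CommRing C] (φ : B →+* C) {b : B}
    (hb : IsUnit b) : φ (Ring.inverse b) = Ring.inverse (φ b) := by
  obtain ⟨u, rfl⟩ := hb
  have h : φ u = (Units.map (φ : B →* C) u : C) := rfl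
  rw [h, Ring.inverse_unit, Ring.inverse_unit, ← map_inv]
  rfl

section BaseChange

variable {K L : Type*} [CommRing K] [CommRing L] (f : K →+* L) (q : ℕ) {lam : K} {mu : L}
  (h : f lam = mu)

lemma baseChange_algebraMap_mvPolynomial (c : MvPolynomial (Fin q) K) :
    baseChange f q h (algebraMap _ _ c) = algebraMap _ _ (MvPolynomial.map f c) := by
  simp [baseChange, IsLocalization.Away.lift_eq]

lemma baseChange_x (k : ℕ) : baseChange f q h (x q lam k) = x q mu k := by
  rw [x, baseChange_algebraMap_mvPolynomial, x]
  congr 1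
  unfold xPoly
  split <;> simp

lemma baseChange_y (r : ℕ) : baseChange f q h (y q lam r) = y q mu r := by
  rw [← algebraMap_yPoly, baseChange_algebraMap_mvPolynomial, map_yPoly f q h, algebraMap_yPoly]

lemma baseChange_algebraMap (c : K) :
    baseChange f q h (algebraMap K _ c) = algebraMap L _ (f c) := by
  rw [IsScalarTower.algebraMap_apply K (MvPolynomial (Fin q) K), MvPolynomial.algebraMap_eq,
    baseChange_algebraMap_mvPolynomial, MvPolynomial.map_C,
    IsScalarTower.algebraMap_apply L (MvPolynomial (Fin q) L), MvPolynomial.algebraMap_eq]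

lemma baseChange_smul (c : K) (b : S q lam) :
    baseChange f q h (c • b) = f c • baseChange f q h b := by
  rw [Algebra.smul_def, map_mul, baseChange_algebraMap, Algebra.smul_def]

/-- The ring map `K[T]/(T^q) → L[T]/(T^q)` induced by `K → L`. -/
noncomputable def baseChangeA : A K q →+* A L q :=
  AdjoinRoot.lift ((algebraMap L (A L q)).comp f) (tA L q) (by simp [tA_pow])

lemma baseChangeA_tA : baseChangeA f q (tA K q) = tA L q := by
  simp [baseChangeA]

lemma baseChangeA_smul (c : K) (a : A K q) :
    baseChangeA f q (c • a) = f c • baseChangeA f q a := by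
  rw [Algebra.smul_def, map_mul, Algebra.smul_def]
  congr 1
  simp [baseChangeA, AdjoinRoot.algebraMap_eq]

lemma psi_eq_sum (a : A K q) : psi q lam a = ∑ k : Fin q, coeffA K q k a • x q lam k := by
  conv_lhs => rw [← sum_coeffA_smul q a]
  simp [psi_pow]

lemma baseChange_psi (a : A K q) :
    baseChange f q h (psi q lam a) = psi q mu (baseChangeA f q a) := by
  conv_rhs => rw [← sum_coeffA_smul q a]
  rw [psi_eq_sum, map_sum, map_sum, map_sum]
  refine sum_congr rfl fun k _ => ?_
  rw [baseChange_smul, baseChange_x, baseChangeA_smul, map_smul, map_pow, baseChangeA_tA, psi_pow]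

end BaseChange

/-- The coaction commutes with base change. Both composites are ring maps out of a localized
polynomial ring, so constants and variables suffice, and there the formula `rho_x` has the same
shape over `K` and `L`. -/
lemma baseChange_mem_coinv {K L : Type*} [CommRing K] [CommRing L] (f : K →+* L) (p n : ℕ)
    [Fact p.Prime] [Algebra (ZMod p) K] [Algebra (ZMod p) L] {lam : K} {mu : L} (h : f lam = mu)
    {b : S (p ^ n) lam} (hb : b ∈ coinv p n lam) :
    baseChange f (p ^ n) h b ∈ coinv p n mu := by
  obtain ⟨Φ, hΦ⟩ := exists_tensorProduct_ringHom (K := K)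
    ((Algebra.TensorProduct.includeLeft :
      S (p ^ n) mu →ₐ[L] S (p ^ n) mu ⊗[L] A L (p ^ n)).toRingHom.comp (baseChange f (p ^ n) h))
    ((Algebra.TensorProduct.includeRight :
      A L (p ^ n) →ₐ[L] S (p ^ n) mu ⊗[L] A L (p ^ n)).toRingHom.comp (baseChangeA f (p ^ n))) (by
        refine RingHom.ext fun c => ?_
        simp only [RingHom.comp_apply, AlgHom.toRingHom_eq_coe, RingHom.coe_coe]
        rw [baseChange_algebraMap, AlgHom.commutes, Algebra.algebraMap_eq_smul_one (R := K),
          baseChangeA_smul, map_one, ← Algebra.algebraMap_eq_smul_one, AlgHom.commutes])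
  have hΦ' : ∀ a b, Φ (a ⊗ₜ b) = baseChange f (p ^ n) h a ⊗ₜ baseChangeA f (p ^ n) b := by
    intro a b
    rw [hΦ]
    simp
  have hΦsmul : ∀ (c : K) w, Φ (c • w) = f c • Φ w := by
    intro c w
    rw [Algebra.smul_def, map_mul, Algebra.TensorProduct.algebraMap_apply, hΦ', map_one,
      baseChange_algebraMap, ← Algebra.TensorProduct.algebraMap_apply, ← Algebra.smul_def]
  have key : Φ.comp (rho p n lam).toRingHom =
      (rho p n mu).toRingHom.comp (baseChange f (p ^ n) h) := by
    refine IsLocalization.ringHom_ext (Submonoid.powers (deltaPoly (p ^ n) lam)) ?_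
    refine MvPolynomial.ringHom_ext (fun c => ?_) fun i => ?_
    · simp only [RingHom.comp_apply, AlgHom.toRingHom_eq_coe, RingHom.coe_coe]
      rw [← MvPolynomial.algebraMap_eq,
        ← IsScalarTower.algebraMap_apply K (MvPolynomial (Fin (p ^ n)) K) (S (p ^ n) lam),
        baseChange_algebraMap,
        AlgHom.commutes, AlgHom.commutes,
        Algebra.algebraMap_eq_smul_one, hΦsmul, map_one, ← Algebra.algebraMap_eq_smul_one]
    · have hi : algebraMap (MvPolynomial (Fin (p ^ n)) K) (S (p ^ n) lam) (MvPolynomial.X i) =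
          x (p ^ n) lam i := by
        simp [x, xPoly]
      simp only [RingHom.comp_apply, AlgHom.toRingHom_eq_coe, RingHom.coe_coe]
      rw [hi, baseChange_x, rho_x, rho_x, map_sum]
      refine sum_congr rfl fun l _ => ?_
      rw [hΦsmul, hΦ', baseChange_psi]
      simp only [map_natCast, map_mul, map_pow, map_add, map_one, baseChangeA_smul,
        baseChangeA_tA, h]
  have h1 := RingHom.congr_fun key b
  simp only [RingHom.comp_apply, AlgHom.toRingHom_eq_coe, RingHom.coe_coe] at h1
  rw [mem_coinv] at hb ⊢
  rw [← h1, hb, hΦ', map_one]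

/-- A numerator that dies is killed by a power of `Δ`; injectivity on polynomials pulls this
relation back, so `Δ` need not be regular. -/
lemma toLaurentS_injective (R : Type*) [CommRing R] (q : ℕ) :
    Function.Injective (toLaurentS R q) := by
  rw [injective_iff_map_eq_zero]
  intro b hb
  obtain ⟨c, d, rfl⟩ :=
    IsLocalization.exists_mk'_eq (Submonoid.powers (deltaPoly q (Polynomial.X : R[X]))) b
  have h1 : toLaurentS R q (algebraMap _ _ c) = 0 := by
    rw [← IsLocalization.mk'_spec (S q (Polynomial.X : R[X])) c d, map_mul, hb, zero_mul]
  rw [toLaurentS, baseChange_algebraMap_mvPolynomial, IsLocalization.map_eq_zero_iff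
    (Submonoid.powers (deltaPoly q (LaurentPolynomial.T 1 : R[T;T⁻¹])))] at h1
  obtain ⟨⟨_, m, rfl⟩, hm⟩ := h1
  simp only at hm
  rw [← map_deltaPoly Polynomial.toLaurent q Polynomial.toLaurent_X, ← map_pow, ← map_mul,
    map_eq_zero_iff _ (MvPolynomial.map_injective _ Polynomial.toLaurent_injective)] at hm
  rw [IsLocalization.mk'_eq_zero_iff]
  exact ⟨⟨_, m, rfl⟩, hm⟩

/-! ### Flatness, which makes a regular base element act injectively -/

instance flat_S {K : Type*} [CommRing K] (q : ℕ) (lam : K) : Module.Flat K (S q lam) :=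
  haveI : Module.Flat (MvPolynomial (Fin q) K) (S q lam) :=
    IsLocalization.flat _ (Submonoid.powers (deltaPoly q lam))
  Module.Flat.trans K (MvPolynomial (Fin q) K) (S q lam)

instance flat_S_tensor_A {K : Type*} [CommRing K] (q : ℕ) (lam : K) :
    Module.Flat K (S q lam ⊗[K] A K q) :=
  haveI : Module.Free K (A K q) := (Polynomial.monic_X_pow q).free_adjoinRoot
  inferInstance

/-! ### The coinvariants `(y_1 / x_0)^k x_0 / y_k` -/

section Ratio

variable {K : Type*} [CommRing K]

/-- The element `(y_1 / x_0)^k x_0 / y_k`. -/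
noncomputable def ratio (q : ℕ) (lam : K) (k : ℕ) : S q lam :=
  (Ring.inverse (x q lam 0) * y q lam 1) ^ k * x q lam 0 * Ring.inverse (y q lam k)

/-- Newton's forward difference formula for `ratio` at `0`, multiplied by `x 0 ^ s`. -/
lemma x_zero_pow_mul_ratio_eq_sum {q : ℕ} {lam : K} {Q : ℕ → S q lam}
    (hQ : ∀ s, lam ^ s • Q s = x q lam 0 ^ s * (fwdDiff 1)^[s] (ratio q lam) 0) (s : ℕ) :
    x q lam 0 ^ s * ratio q lam s =
      ∑ k ∈ range (s + 1), ((s.choose k : K) * lam ^ k) • (x q lam 0 ^ (s - k) * Q k) := by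
  have h := shift_eq_sum_fwdDiff_iter 1 (ratio q lam) s 0
  rw [zero_add, smul_eq_mul, mul_one] at h
  rw [h, mul_sum]
  refine sum_congr rfl fun k hk => ?_
  rw [mul_smul, ← mul_smul_comm, hQ, ← mul_assoc, ← pow_add,
    Nat.sub_add_cancel (Nat.lt_succ_iff.mp (mem_range.mp hk)), Nat.cast_smul_eq_nsmul,
    mul_smul_comm]

variable (p n : ℕ) [Fact p.Prime] [Algebra (ZMod p) K] (lam : K)

lemma ratio_mul_y (k : ℕ) : ratio (p ^ n) lam k * y (p ^ n) lam k =
    (Ring.inverse (x (p ^ n) lam 0) * y (p ^ n) lam 1) ^ k * x (p ^ n) lam 0 := by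
  rw [ratio, mul_assoc, Ring.inverse_mul_cancel _ (isUnit_y_of_prime_pow p n lam k), mul_one]

lemma ratio_mem_coinv (k : ℕ) : ratio (p ^ n) lam k ∈ coinv p n lam := by
  refine coinv_of_mul_y p n lam (r := k) ?_
  rw [ratio_mul_y, map_mul, map_pow, map_mul, (mem_coinv p n lam).mp (x_zero_mem_coinv p n lam),
    (mem_coinv p n lam).mp (inverse_x_zero_mem_coinv p n lam), rho_y]
  simp [Algebra.TensorProduct.tmul_pow]

lemma ratio_zero : ratio (p ^ n) lam 0 = 1 := by
  rw [ratio, y_zero, pow_zero, one_mul, Ring.mul_inverse_cancel _ (isUnit_x_zero p n lam)]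

lemma ratio_one : ratio (p ^ n) lam 1 = 1 := by
  have h1 := Ring.mul_inverse_cancel _ (isUnit_x_zero p n lam)
  have h2 := Ring.mul_inverse_cancel _ (isUnit_y_of_prime_pow p n lam 1)
  rw [ratio, pow_one]
  linear_combination y (p ^ n) lam 1 * Ring.inverse (y (p ^ n) lam 1) * h1 + h2

lemma x_zero_pow_mul_ratio (s : ℕ) : x (p ^ n) lam 0 ^ s * ratio (p ^ n) lam s =
    (x (p ^ n) lam 0 + lam • x (p ^ n) lam 1) ^ s * x (p ^ n) lam 0 *
      Ring.inverse (y (p ^ n) lam s) := by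
  rw [ratio, ← mul_assoc, ← mul_assoc, ← mul_pow, ← mul_assoc,
    Ring.mul_inverse_cancel _ (isUnit_x_zero p n lam), one_mul, y_one]

lemma inverse_mul_y_one : Ring.inverse (x (p ^ n) lam 0) * y (p ^ n) lam 1 =
    1 + lam • (Ring.inverse (x (p ^ n) lam 0) * x (p ^ n) lam 1) := by
  rw [y_one, mul_add, Ring.inverse_mul_cancel _ (isUnit_x_zero p n lam), mul_smul_comm]

lemma fwdDiff_iter_y (q : ℕ) (mu : K) (s m : ℕ) : (fwdDiff 1)^[s] (y q mu) m =
    mu ^ s • psi q mu ((1 + mu • tA K q) ^ m * tA K q ^ s) := by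
  have h : y q mu = fun k => (psi q mu).toAddMonoidHom ((1 + mu • tA K q) ^ k) :=
    funext fun k => (psi_add_pow q mu k).symm
  rw [h, fwdDiff_iter_map, fwdDiff_iter_one_add_pow, smul_pow, smul_mul_assoc,
    LinearMap.toAddMonoidHom_coe, map_smul, mul_comm]

lemma fwdDiff_iter_ratio_mul_y (s m : ℕ) :
    (fwdDiff 1)^[s] (ratio (p ^ n) lam * y (p ^ n) lam) m =
      (lam • (Ring.inverse (x (p ^ n) lam 0) * x (p ^ n) lam 1)) ^ s *
        (1 + lam • (Ring.inverse (x (p ^ n) lam 0) * x (p ^ n) lam 1)) ^ m *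
        x (p ^ n) lam 0 := by
  have h : ratio (p ^ n) lam * y (p ^ n) lam = fun k => AddMonoidHom.mulRight (x (p ^ n) lam 0)
      ((1 + lam • (Ring.inverse (x (p ^ n) lam 0) * x (p ^ n) lam 1)) ^ k) := by
    funext k
    rw [Pi.mul_apply, ratio_mul_y, inverse_mul_y_one]
    rfl
  rw [h, fwdDiff_iter_map, fwdDiff_iter_one_add_pow]
  rfl

/-- `ratio` is the product of `ratio * y` and the inverse of `y`; the differences of `ratio * y` and
of `y` are explicit. -/
lemma diffDvd_ratio : DiffDvd (algebraMap K (S (p ^ n) lam) lam) (ratio (p ^ n) lam) := by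
  have hy : DiffDvd (algebraMap K (S (p ^ n) lam) lam) (y (p ^ n) lam) := by
    intro s m
    rw [fwdDiff_iter_y, Algebra.smul_def, map_pow]
    exact dvd_mul_right _ _
  have hry : DiffDvd (algebraMap K (S (p ^ n) lam) lam) (ratio (p ^ n) lam * y (p ^ n) lam) := by
    intro s m
    rw [fwdDiff_iter_ratio_mul_y, Algebra.smul_def, mul_pow, mul_assoc, mul_assoc]
    exact dvd_mul_right _ _
  have hu : y (p ^ n) lam * (fun k => Ring.inverse (y (p ^ n) lam k)) = 1 :=
    funext fun k => Ring.mul_inverse_cancel _ (isUnit_y_of_prime_pow p n lam k)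
  have h := hry.mul (hy.of_mul_eq_one hu)
  rwa [mul_assoc, hu, mul_one] at h

lemma exists_pow_smul_eq_fwdDiff_ratio : ∃ Q : ℕ → S (p ^ n) lam, ∀ s,
    lam ^ s • Q s = x (p ^ n) lam 0 ^ s * (fwdDiff 1)^[s] (ratio (p ^ n) lam) 0 := by
  choose c hc using fun s => diffDvd_ratio p n lam s 0
  refine ⟨fun s => x (p ^ n) lam 0 ^ s * c s, fun s => ?_⟩
  rw [hc, Algebra.smul_def, map_pow]
  ring

/-! ### The divided differences `Q s`, which become `P_(Λ)(X_T^s)` -/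

variable {p n lam} {Q : ℕ → S (p ^ n) lam}
  (hQ : ∀ s, lam ^ s • Q s = x (p ^ n) lam 0 ^ s * (fwdDiff 1)^[s] (ratio (p ^ n) lam) 0)

include hQ

lemma fwdDiff_quotient_zero : Q 0 = 1 := by
  simpa [ratio_zero] using hQ 0

lemma fwdDiff_quotient_one (hreg : IsSMulRegular (S (p ^ n) lam) lam) : Q 1 = 0 := by
  refine hreg ?_
  simpa [fwdDiff, ratio_zero, ratio_one] using hQ 1

/-- `λ ^ s • Q s` is `x 0 ^ s` times an integer combination of coinvariant ratios, and `λ ^ s`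
cancels in `S ⊗ A`. -/
lemma fwdDiff_quotient_mem_coinv (hreg : IsSMulRegular (S (p ^ n) lam ⊗[K] A K (p ^ n)) lam)
    (s : ℕ) : Q s ∈ coinv p n lam := by
  have h1 : lam ^ s • Q s ∈ coinv p n lam := by
    rw [hQ, fwdDiff_iter_eq_sum_shift]
    exact mul_mem (pow_mem (x_zero_mem_coinv p n lam) _)
      (sum_mem fun k _ => zsmul_mem (ratio_mem_coinv p n lam _) _)
  rw [mem_coinv, map_smul, ← TensorProduct.smul_tmul'] at h1
  exact hreg.pow s h1

/-- Computes the `s`-th difference of `ratio * y` at `0` twice, by the Leibniz rule and as a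
geometric sequence, then cancels `λ ^ s`. -/
lemma x_one_pow_eq_sum (hreg : IsSMulRegular (S (p ^ n) lam) lam) (s : ℕ) :
    x (p ^ n) lam 1 ^ s = ∑ ij ∈ antidiagonal s,
      (s.choose ij.1 : S (p ^ n) lam) * x (p ^ n) lam 0 ^ ij.2 *
        Ring.inverse (x (p ^ n) lam 0) * Q ij.1 *
        psi (p ^ n) lam ((1 + lam • tA K (p ^ n)) ^ ij.1 * tA K (p ^ n) ^ ij.2) := by
  have hx := Ring.mul_inverse_cancel _ (isUnit_x_zero p n lam)
  refine hreg.pow s ?_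
  have h := fwdDiff_iter_mul (ratio (p ^ n) lam) (y (p ^ n) lam) s 0
  rw [fwdDiff_iter_ratio_mul_y, pow_zero, mul_one] at h
  -- The factor `x 0 ^ s * (x 0)⁻¹` plays the role of `x 0 ^ (s - 1)` and also covers `s = 0`.
  have h2 : lam ^ s • x (p ^ n) lam 1 ^ s =
      x (p ^ n) lam 0 ^ s * Ring.inverse (x (p ^ n) lam 0) *
        ((lam • (Ring.inverse (x (p ^ n) lam 0) * x (p ^ n) lam 1)) ^ s * x (p ^ n) lam 0) := by
    rw [smul_pow, mul_pow, smul_mul_assoc, mul_smul_comm]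
    congr 1
    have hs : x (p ^ n) lam 0 ^ s * Ring.inverse (x (p ^ n) lam 0) ^ s = 1 := by
      rw [← mul_pow, hx, one_pow]
    linear_combination (-(x (p ^ n) lam 1 ^ s * x (p ^ n) lam 0 *
      Ring.inverse (x (p ^ n) lam 0))) * hs - x (p ^ n) lam 1 ^ s * hx
  simp only
  rw [h2, h, smul_sum, mul_sum]
  refine sum_congr rfl fun ij hij => ?_
  rw [HasAntidiagonal.mem_antidiagonal] at hij
  have h3 := hQ ij.1
  rw [zero_add, fwdDiff_iter_y]
  simp only [Algebra.smul_def, ← hij, pow_add, map_mul] at h3 ⊢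
  linear_combination (-((ij.1 + ij.2).choose ij.1 : S (p ^ n) lam) * x (p ^ n) lam 0 ^ ij.2 *
    Ring.inverse (x (p ^ n) lam 0) * algebraMap K _ (lam ^ ij.2) *
    psi (p ^ n) lam ((1 + algebraMap K _ lam * tA K (p ^ n)) ^ ij.1 * tA K (p ^ n) ^ ij.2)) * h3

end Ratio

/-- The recursion for `P` is solved by every family with the same Newton expansion. -/
lemma eq_P_of_newton (R : Type*) [CommRing R] (p n : ℕ) [Fact p.Prime] [Algebra (ZMod p) R]
    {Q : ℕ → S (p ^ n) (LaurentPolynomial.T 1 : R[T;T⁻¹])} (h0 : Q 0 = 1) (h1 : Q 1 = 0)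
    (hQ : ∀ s, x (p ^ n) (LaurentPolynomial.T 1 : R[T;T⁻¹]) 0 ^ s * ratio (p ^ n) _ s =
      ∑ k ∈ range (s + 1), ((s.choose k : R[T;T⁻¹]) * LaurentPolynomial.T 1 ^ k) •
        (x (p ^ n) _ 0 ^ (s - k) * Q k)) {s : ℕ} (hs : 2 ≤ s) : Q s = P R (p ^ n) s := by
  induction s using Nat.strong_induction_on with
  | _ s ih =>
    have h2 : ∀ k : Fin s, (if 2 ≤ (k : ℕ) then
        ((s.choose k : R[T;T⁻¹]) * LaurentPolynomial.T 1 ^ (k : ℕ)) •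
          (x (p ^ n) (LaurentPolynomial.T 1) 0 ^ (s - k) * P R (p ^ n) k) else 0) =
        (fun k : ℕ => if 2 ≤ k then ((s.choose k : R[T;T⁻¹]) * LaurentPolynomial.T 1 ^ k) •
          (x (p ^ n) (LaurentPolynomial.T 1) 0 ^ (s - k) * Q k) else 0) k := by
      intro k
      by_cases hk : 2 ≤ (k : ℕ)
      · simp only [if_pos hk, ih k k.2 hk]
      · simp only [if_neg hk]
    rw [P, ← x_zero_pow_mul_ratio, hQ, sum_congr rfl fun k _ => h2 k, Fin.sum_univ_eq_sum_range
      (fun k : ℕ => if 2 ≤ k then ((s.choose k : R[T;T⁻¹]) * LaurentPolynomial.T 1 ^ k) •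
        (x (p ^ n) (LaurentPolynomial.T 1) 0 ^ (s - k) * Q k) else 0), sum_range_succ]
    obtain ⟨t, rfl⟩ := Nat.exists_eq_add_of_le' hs
    -- Two splittings for each of the two sums detach `k = 0`, which gives `X_1 ^ s`, and `k = 1`,
    -- which gives `0`; the rest cancels except the term `k = s`.
    rw [sum_range_succ', sum_range_succ', sum_range_succ', sum_range_succ']
    simp only [h0, h1, Nat.choose_self, Nat.choose_zero_right, tsub_self, pow_zero, mul_one,
      Nat.cast_one, one_smul, mul_zero, smul_zero, tsub_zero, zero_add, add_zero, one_mul,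
      if_neg (show ¬ 2 ≤ 1 by norm_num), if_neg (show ¬ 2 ≤ 0 by norm_num)]
    simp only [show ∀ k, 2 ≤ k + 1 + 1 from Nat.le_add_left 2, if_true]
    rw [add_sub_right_comm, add_sub_cancel_right, add_sub_cancel_left, smul_smul,
      LaurentPolynomial.T_pow, ← LaurentPolynomial.T_add]
    simp

end GrothendieckResolution

open GrothendieckResolution in
theorem proposition3p4 (p n : ℕ) [Fact p.Prime] (hn : 0 < n) (R : Type*) [CommRing R]
    [Algebra (ZMod p) R] :
    -- `R[Λ][X, 1/Δ]` is a subring of `R[Λ, 1/Λ][X, 1/Δ]`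
    Function.Injective (toLaurentS R (p ^ n)) ∧
    ∃ Q : ℕ → S (p ^ n) (Polynomial.X : Polynomial R),
      ∀ s : ℕ, 2 ≤ s → s ≤ p ^ n - 1 →
        toLaurentS R (p ^ n) (Q s) = P R (p ^ n) s ∧
        Q s ∈ coinv p n (Polynomial.X : Polynomial R) ∧
        (∀ lam : R, specialize (p ^ n) lam (Q s) ∈ coinv p n lam) ∧
        ∃ a : Fin (p ^ n) → S (p ^ n) (Polynomial.X : Polynomial R),
          (∀ k, a k ∈ Algebra.adjoin (Polynomial R)
            (gens (p ^ n) (Polynomial.X : Polynomial R) Q)) ∧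
          PsiInvEq p n (Polynomial.X : Polynomial R) (x (p ^ n) Polynomial.X 1 ^ s) a ∧
          PsiInvEq p n (LaurentPolynomial.T 1 : LaurentPolynomial R)
            (x (p ^ n) (LaurentPolynomial.T 1) 1 ^ s) (fun k => toLaurentS R (p ^ n) (a k)) ∧
          ∀ lam : R,
            (∀ k, specialize (p ^ n) lam (a k) ∈ Algebra.adjoin R
              (gens (p ^ n) lam (fun i => specialize (p ^ n) lam (Q i)))) ∧
            PsiInvEq p n lam (x (p ^ n) lam 1 ^ s)
              (fun k => specialize (p ^ n) lam (a k)) := by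
  refine ⟨toLaurentS_injective R _, ?_⟩
  have hX : IsRegular (Polynomial.X : Polynomial R) := Polynomial.monic_X.isRegular
  have hreg : IsSMulRegular (S (p ^ n) (Polynomial.X : Polynomial R))
      (Polynomial.X : Polynomial R) :=
    Module.Flat.isSMulRegular_of_isRegular hX
  obtain ⟨Q, hQ⟩ := exists_pow_smul_eq_fwdDiff_ratio p n (Polynomial.X : Polynomial R)
  have hcoinv : ∀ s, Q s ∈ coinv p n (Polynomial.X : Polynomial R) :=
    fwdDiff_quotient_mem_coinv hQ (Module.Flat.isSMulRegular_of_isRegular hX)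
  have hadj : Algebra.adjoin (Polynomial R) (gens (p ^ n) (Polynomial.X : Polynomial R) Q) ≤
      coinv p n (Polynomial.X : Polynomial R) := by
    refine Algebra.adjoin_le ?_
    rintro _ ((rfl | rfl) | ⟨k, _, rfl⟩)
    · exact x_zero_mem_coinv p n _
    · exact inverse_x_zero_mem_coinv p n _
    · exact hcoinv k
  refine ⟨Q, fun s hs hsq => ⟨?_, hcoinv s, fun lam => baseChange_mem_coinv _ p n _ (hcoinv s), ?_⟩⟩
  · refine eq_P_of_newton R p n (Q := fun s => toLaurentS R (p ^ n) (Q s)) ?_ ?_ (fun s => ?_) hs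
    · rw [fwdDiff_quotient_zero hQ, map_one]
    · rw [fwdDiff_quotient_one hQ hreg, map_zero]
    -- Only the Newton expansion is transported to the Laurent ring; there it determines `P`.
    · have h := congrArg (toLaurentS R (p ^ n)) (x_zero_pow_mul_ratio_eq_sum hQ s)
      simpa only [ratio, toLaurentS, map_mul, map_pow, map_sum, baseChange_smul, baseChange_x,
        baseChange_y, map_ringInverse _ (isUnit_x_zero p n (Polynomial.X : Polynomial R)),
        map_ringInverse _ (isUnit_y_of_prime_pow p n (Polynomial.X : Polynomial R) s),
        map_natCast, Polynomial.toLaurent_X] using h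
  have hQadj : ∀ i ≤ s, Q i ∈
      Algebra.adjoin (Polynomial R) (gens (p ^ n) (Polynomial.X : Polynomial R) Q) := by
    intro i hi
    match i with
    | 0 => rw [fwdDiff_quotient_zero hQ]; exact one_mem _
    | 1 => rw [fwdDiff_quotient_one hQ hreg]; exact zero_mem _
    | i + 2 => exact Algebra.subset_adjoin (Or.inr ⟨i + 2, ⟨by omega, by omega⟩, rfl⟩)
  -- Collects the coefficient of `x k` in `x_one_pow_eq_sum`, expanding each `(1 + ΛT) ^ i * T ^ j`
  -- in powers of `T`.
  let a : Fin (p ^ n) → S (p ^ n) (Polynomial.X : Polynomial R) := fun k =>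
    ∑ ij ∈ Finset.HasAntidiagonal.antidiagonal s, coeffA (Polynomial R) (p ^ n) k
      ((1 + (Polynomial.X : Polynomial R) • tA _ (p ^ n)) ^ ij.1 * tA _ (p ^ n) ^ ij.2) •
        ((s.choose ij.1 : S (p ^ n) (Polynomial.X : Polynomial R)) * x (p ^ n) _ 0 ^ ij.2 *
          Ring.inverse (x (p ^ n) _ 0) * Q ij.1)
  have ha : ∀ k, a k ∈
      Algebra.adjoin (Polynomial R) (gens (p ^ n) (Polynomial.X : Polynomial R) Q) := by
    intro k
    refine Subalgebra.sum_mem _ fun ij hij => Subalgebra.smul_mem _ ?_ _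
    have hx := Algebra.subset_adjoin (R := Polynomial R) (show x (p ^ n) Polynomial.X 0 ∈
      gens (p ^ n) (Polynomial.X : Polynomial R) Q from Or.inl (Or.inl rfl))
    have hx' := Algebra.subset_adjoin (R := Polynomial R)
      (show Ring.inverse (x (p ^ n) Polynomial.X 0) ∈
        gens (p ^ n) (Polynomial.X : Polynomial R) Q from Or.inl (Or.inr rfl))
    refine mul_mem (mul_mem (mul_mem (natCast_mem _ _) (pow_mem hx _)) hx') (hQadj _ ?_)
    rw [Finset.HasAntidiagonal.mem_antidiagonal] at hij
    omega
  have hsum : ∑ k, a k * x (p ^ n) (Polynomial.X : Polynomial R) k =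
      x (p ^ n) (Polynomial.X : Polynomial R) 1 ^ s := by
    rw [x_one_pow_eq_sum hQ hreg]
    simp only [a, Finset.sum_mul, psi_eq_sum, Finset.mul_sum, smul_mul_assoc, mul_smul_comm]
    exact Finset.sum_comm
  refine ⟨a, ha, psiInvEq_of_sum_eq p n _ (fun k => hadj (ha k)) hsum, ?_,
    fun lam => ⟨fun k => ?_, ?_⟩⟩
  · refine psiInvEq_of_sum_eq p n _ (fun k => baseChange_mem_coinv _ p n _ (hadj (ha k))) ?_
    have h := congrArg (toLaurentS R (p ^ n)) hsum
    simpa only [toLaurentS, map_sum, map_mul, map_pow, baseChange_x] using h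
  · have hb := ha k
    generalize a k = b at hb ⊢
    induction hb using Algebra.adjoin_induction with
    | mem b hb =>
      refine Algebra.subset_adjoin ?_
      rcases hb with (rfl | rfl) | ⟨i, hi, rfl⟩
      · exact Or.inl (Or.inl (baseChange_x _ _ _ _))
      · refine Or.inl (Or.inr ?_)
        rw [map_ringInverse _ (isUnit_x_zero p n _), specialize, baseChange_x]
        rfl
      · exact Or.inr ⟨i, hi, rfl⟩
    | algebraMap r =>
      rw [specialize, baseChange_algebraMap]
      exact Subalgebra.algebraMap_mem _ _
    | add b c _ _ hb hc => rw [map_add]; exact add_mem hb hc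
    | mul b c _ _ hb hc => rw [map_mul]; exact mul_mem hb hc
  · refine psiInvEq_of_sum_eq p n _ (fun k => baseChange_mem_coinv _ p n _ (hadj (ha k))) ?_
    have h := congrArg (specialize (p ^ n) lam) hsum
    simpa only [specialize, map_sum, map_mul, map_pow, baseChange_x] using h
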